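/- Let $q\in\mathbb C$ with $0<|q|<1$. Write $(x;q)_\infty=\prod_{j\ge 0}(1-xq^j)$, $(x;q)_n=\prod_{0\le j<n}(1-xq^j)$ for integers $n\ge 0$, $(x_1,\dots,x_m;q)_n=(x_1;q)_n\cdots(x_m;q)_n$ for $n\in\{0,1,2,\dots\}\cup\{\infty\}$, and $\begin{bmatrix}n\\ m\end{bmatrix}_q=\frac{(q;q)_n}{(q;q)_m(q;q)_{n-m}}$ for integers $0\le m\le n$. Let $k\ge 1$ be an integer and let $a,b,z\in\mathbb C$ with $b\ne 0$ be such that no denominator on the left-hand side below vanishes, i.e. $(az,bz;q)_\infty\ne 0$ and $(-abz,-qz;q)_n\neq 0$ for $0\le n<k$. Then $$ 1-\frac{(-abz,-qz;q)_\infty}{(az,bz;q)_\infty}\sum_{0\le n<k}\frac{(1-azq^{2n})\,(-q/b,-a,az;q)_n}{(-abz,-qz,q;q)_n}\,q^{\binom n2}(-bz)^n $$ $$ =(-1)^k(-a;q)_k\sum_{h,\ell\ge 0}\frac{(-b;q)_h\,(-q/b;q)_{\ell+k}\;q^{\binom k2}\,(aq^kz)^h\,(bz)^{\ell+k}}{(q;q)_{h+\ell+k}}\begin{bmatrix}h+\ell+k-1\\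 k-1\end{bmatrix}_q\begin{bmatrix}h+\ell\\ \ell\end{bmatrix}_q $$ whenever the double series on the right-hand side converges absolutely; and this double series does converge absolutely if $|aq^kz|<1$ and $|bz|<1$. -/

import Mathlib

/-- The infinite `q`-shifted factorial `(a; q)_∞ = ∏_{j ≥ 0} (1 - a q^j)`. -/
noncomputable def qPochInf (a q : ℂ) : ℂ := ∏' j : ℕ, (1 - a * q ^ j)

/-- The finite `q`-shifted factorial `(a; q)_n = ∏_{0 ≤ j < n} (1 - a q^j)`, which is
`(a; q)_∞ / (a q^n; q)_∞` whenever the latter denominator does not vanish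
(see `qPoch_eq_div`). -/
noncomputable def qPoch (a q : ℂ) (n : ℕ) : ℂ := ∏ j ∈ Finset.range n, (1 - a * q ^ j)

/-- The `q`-binomial coefficient `(q; q)_n / ((q; q)_k (q; q)_{n-k})`, which is `0` for `k > n`. -/
noncomputable def qBinom (q : ℂ) (n k : ℕ) : ℂ :=
  if k ≤ n then qPoch q q n / (qPoch q q k * qPoch q q (n - k)) else 0

theorem qPochInf_multipliable (a q : ℂ) (hq : ‖q‖ < 1) :
    Multipliable (fun j : ℕ => 1 - a * q ^ j) := by
  have h : Summable (fun j : ℕ => ‖-(a * q ^ j)‖) := by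
    simp only [norm_neg, norm_mul, norm_pow]
    exact (summable_geometric_of_lt_one (norm_nonneg q) hq).mul_left _
  simpa [sub_eq_add_neg] using multipliable_one_add_of_summable h

theorem qPoch_mul_qPochInf (a q : ℂ) (hq : ‖q‖ < 1) (n : ℕ) :
    qPoch a q n * qPochInf (a * q ^ n) q = qPochInf a q := by
  induction n with
  | zero => simp [qPoch]
  | succ n ih =>
    rw [← ih, qPoch, Finset.prod_range_succ, ← qPoch, mul_assoc]
    have h : Multipliable (fun j : ℕ => 1 - a * q ^ n * q ^ (j + 1)) :=
      (qPochInf_multipliable (a * q ^ n * q) q hq).congr fun j => by ring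
    have e := tprod_eq_zero_mul' (f := fun j : ℕ => 1 - a * q ^ n * q ^ j) h
    have e' : qPochInf (a * q ^ n) q =
        (1 - a * q ^ n) * ∏' j : ℕ, (1 - a * q ^ n * q ^ (j + 1)) := by
      simpa [qPochInf] using e
    have e'' : qPochInf (a * q ^ (n + 1)) q = ∏' j : ℕ, (1 - a * q ^ n * q ^ (j + 1)) :=
      tprod_congr fun j => by ring
    rw [e', e'']

theorem qPoch_eq_div (a q : ℂ) (hq : ‖q‖ < 1) (n : ℕ) (h : qPochInf (a * q ^ n) q ≠ 0) :
    qPoch a q n = qPochInf a q / qPochInf (a * q ^ n) q := by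
  rw [eq_div_iff h, qPoch_mul_qPochInf a q hq n]

/-- The `n`-th term of the very-well-poised `₅φ₅` summation, with `-a`, `-b`, `-z` in place of
`a`, `b`, `z`. -/
noncomputable def fivePhiFiveTerm (a b z q : ℂ) (n : ℕ) : ℂ :=
  (1 - a * z * q ^ (2 * n)) * (qPoch (-q / b) q n * qPoch (-a) q n * qPoch (a * z) q n) /
      (qPoch (-(a * b * z)) q n * qPoch (-(q * z)) q n * qPoch q q n) *
    q ^ (n.choose 2) * (-(b * z)) ^ n

/-- The term with indices `h, l` of the double series, for `k ≥ 1`. -/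
noncomputable def doubleTerm (a b z q : ℂ) (k h l : ℕ) : ℂ :=
  qPoch (-b) q h * qPoch (-q / b) q (l + k) * q ^ (k.choose 2) *
      (a * q ^ k * z) ^ h * (b * z) ^ (l + k) / qPoch q q (h + l + k) *
    qBinom q (h + l + k - 1) (k - 1) * qBinom q (h + l) l

/-!
The proof rests on a first-order `q`-difference equation in `z`. Multiplying the `n`-th term of
the `₅φ₅` sum by the infinite products in front of it cancels the denominators that depend on
`-abz` and `-qz`, and gives `bₙ (1 - a z q²ⁿ) zⁿ Wₙ(z)`, where `bₙ` does not depend on `z` and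
`Wₙ(z) = (-abzqⁿ, -zqⁿ⁺¹; q)_∞ / (azqⁿ, bz; q)_∞`. If `L_k(z)` is the left-hand side of the
theorem written in this way, then `L_k(z) - L_k(qz) = (1 - q^k) b_k z^k W_k(z)`
(`remainder_sub_remainder`, a telescoping induction on `k`), and `L_k(q^j z) → 0` as `j → ∞`.

On the other side, the terms of the double series factor as
`(1 - q^k) b_k z^k u_h v_l / (1 - q^(h+l+k))`, where `∑ u_h` and `∑ v_l` are `q`-binomial series
whose product is `W_k(z)`. The factor `1 / (1 - q^(h+l+k))` makes the double series satisfy the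
same difference equation, and it also tends to `0` along `z, qz, q²z, …`; so the two sides agree.

The `q`-binomial theorem is needed at every point where the series converges absolutely, inside
the unit disc or not (the series may terminate); `tsum_qBinomialTerm` proves it in this form from
its functional equation. Hence no case distinction is needed for the convergence of the double
series: unless its constant factor vanishes, its absolute convergence forces that of the two
single series.
-/

open Filter Topology

/-! ### Shifts and limits of `q`-shifted factorials -/

theorem qPoch_zero (a q : ℂ) : qPoch a q 0 = 1 := by simp [qPoch]

theorem qPoch_succ (a q : ℂ) (n : ℕ) : qPoch a q (n + 1) = qPoch a q n * (1 - a * q ^ n) := by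
  rw [qPoch, Finset.prod_range_succ, ← qPoch]

theorem qPoch_add (a q : ℂ) (m n : ℕ) :
    qPoch a q (m + n) = qPoch a q m * qPoch (a * q ^ m) q n := by
  simp only [qPoch, Finset.prod_range_add]
  congr 1
  exact Finset.prod_congr rfl fun j _ => by ring

theorem one_sub_pow_ne_zero {q : ℂ} (hq : ‖q‖ < 1) {n : ℕ} (hn : n ≠ 0) : 1 - q ^ n ≠ 0 := by
  intro h
  have h1 : ‖q ^ n‖ = 1 := by rw [← sub_eq_zero.mp h, norm_one]
  rw [norm_pow] at h1
  exact (pow_lt_one₀ (norm_nonneg q) hq hn).ne h1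

theorem qPoch_self_ne_zero {q : ℂ} (hq : ‖q‖ < 1) (n : ℕ) : qPoch q q n ≠ 0 := by
  refine Finset.prod_ne_zero_iff.mpr fun j _ => ?_
  rw [← pow_succ']
  exact one_sub_pow_ne_zero hq j.succ_ne_zero

theorem qPochInf_eq_mul {q : ℂ} (hq : ‖q‖ < 1) (a : ℂ) :
    qPochInf a q = (1 - a) * qPochInf (a * q) q := by
  have h := qPoch_mul_qPochInf a q hq 1
  rw [pow_one] at h
  rw [← h, qPoch_succ, qPoch_zero]
  ring

theorem qPochInf_mul_pow_ne_zero {q a : ℂ} (hq : ‖q‖ < 1) (ha : qPochInf a q ≠ 0) (n : ℕ) :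
    qPochInf (a * q ^ n) q ≠ 0 := by
  rw [← qPoch_mul_qPochInf a q hq n] at ha
  exact right_ne_zero_of_mul ha

theorem tendsto_qPoch {q : ℂ} (hq : ‖q‖ < 1) (a : ℂ) :
    Tendsto (fun n => qPoch a q n) atTop (𝓝 (qPochInf a q)) :=
  (qPochInf_multipliable a q hq).hasProd.tendsto_prod_nat

theorem tendsto_qPochInf_mul_pow {q : ℂ} (hq : ‖q‖ < 1) (a : ℂ) :
    Tendsto (fun n : ℕ => qPochInf (a * q ^ n) q) atTop (𝓝 1) := by
  have hbound : ∀ n : ℕ, ‖qPochInf (a * q ^ n) q - 1‖ ≤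
      Real.exp (‖a‖ * ‖q‖ ^ n * (1 - ‖q‖)⁻¹) - 1 := by
    intro n
    have hlim : Tendsto (fun m => ‖qPoch (a * q ^ n) q m - 1‖) atTop
        (𝓝 ‖qPochInf (a * q ^ n) q - 1‖) := ((tendsto_qPoch hq _).sub_const 1).norm
    refine le_of_tendsto' hlim fun m => ?_
    have h := (Finset.range m).norm_prod_one_add_sub_one_le fun j => -(a * q ^ n * q ^ j)
    simp only [← sub_eq_add_neg] at h
    refine h.trans (sub_le_sub_right (Real.exp_le_exp.mpr ?_) 1)
    simp only [norm_neg, norm_mul, norm_pow, ← Finset.mul_sum]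
    gcongr
    rw [← tsum_geometric_of_lt_one (norm_nonneg q) hq]
    exact (summable_geometric_of_lt_one (norm_nonneg q) hq).sum_le_tsum _ fun _ _ => by positivity
  have h0 : Tendsto (fun n : ℕ => Real.exp (‖a‖ * ‖q‖ ^ n * (1 - ‖q‖)⁻¹) - 1) atTop (𝓝 0) := by
    have h := ((tendsto_pow_atTop_nhds_zero_of_lt_one (norm_nonneg q) hq).const_mul
      ‖a‖).mul_const (1 - ‖q‖)⁻¹
    have h' := ((Real.continuous_exp.tendsto _).comp h).sub_const 1
    simpa using h'
  exact tendsto_iff_norm_sub_tendsto_zero.mpr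
    (squeeze_zero (fun _ => norm_nonneg _) hbound h0)

/-! ### The `q`-binomial theorem -/

/-- The `n`-th term `(α; q)_n xⁿ / (q; q)_n` of the `q`-binomial series. -/
noncomputable def qBinomialTerm (α x q : ℂ) (n : ℕ) : ℂ := qPoch α q n * x ^ n / qPoch q q n

theorem qBinomialTerm_zero (α x q : ℂ) : qBinomialTerm α x q 0 = 1 := by
  simp [qBinomialTerm, qPoch_zero]

theorem qBinomialTerm_succ {q : ℂ} (hq : ‖q‖ < 1) (α x : ℂ) (n : ℕ) :
    qBinomialTerm α x q (n + 1) * (1 - q ^ (n + 1)) =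
      x * (1 - α * q ^ n) * qBinomialTerm α x q n := by
  have h1 := qPoch_self_ne_zero hq n
  have h2 := one_sub_pow_ne_zero hq n.succ_ne_zero
  rw [qBinomialTerm, qBinomialTerm, qPoch_succ, qPoch_succ, ← pow_succ' q n,
    pow_succ x]
  field_simp

theorem qBinomialTerm_mul_pow (α x q : ℂ) (j n : ℕ) :
    qBinomialTerm α (x * q ^ j) q n = qBinomialTerm α x q n * q ^ (j * n) := by
  rw [qBinomialTerm, qBinomialTerm, mul_pow, ← pow_mul]
  ring

theorem summable_qBinomialTerm {q x : ℂ} (hq : ‖q‖ < 1) (α : ℂ) (hx : ‖x‖ < 1) :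
    Summable (qBinomialTerm α x q) := by
  obtain ⟨r, hxr, hr⟩ := exists_between hx
  have hpow : Tendsto (fun n : ℕ => q ^ n) atTop (𝓝 0) :=
    tendsto_pow_atTop_nhds_zero_of_norm_lt_one hq
  have hratio : Tendsto (fun n : ℕ => ‖x * (1 - α * q ^ n) / (1 - q ^ (n + 1))‖) atTop
      (𝓝 ‖x‖) := by
    have h := (((hpow.const_mul α).const_sub 1).const_mul x).div
      (((tendsto_add_atTop_iff_nat 1).mpr hpow).const_sub 1) (by simp)
    simpa using h.norm
  refine summable_of_ratio_norm_eventually_le hr ?_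
  filter_upwards [hratio.eventually (gt_mem_nhds hxr)] with n hn
  have h2 := one_sub_pow_ne_zero hq n.succ_ne_zero
  have h : qBinomialTerm α x q (n + 1) =
      x * (1 - α * q ^ n) / (1 - q ^ (n + 1)) * qBinomialTerm α x q n := by
    rw [div_mul_eq_mul_div, eq_div_iff h2, qBinomialTerm_succ hq]
  rw [h, norm_mul]
  gcongr

theorem norm_pow_le_one {q : ℂ} (hq : ‖q‖ < 1) (n : ℕ) : ‖q ^ n‖ ≤ 1 := by
  rw [norm_pow]
  exact pow_le_one₀ (norm_nonneg q) hq.le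

theorem Summable.qBinomialTerm_mul_pow {q α x : ℂ} (hq : ‖q‖ < 1)
    (hs : Summable (qBinomialTerm α x q)) (j : ℕ) :
    Summable (qBinomialTerm α (x * q ^ j) q) := by
  refine Summable.of_norm_bounded hs.norm fun n => ?_
  rw [_root_.qBinomialTerm_mul_pow, norm_mul]
  exact mul_le_of_le_one_right (norm_nonneg _) (norm_pow_le_one hq _)

theorem one_sub_mul_tsum_qBinomialTerm {q α x : ℂ} (hq : ‖q‖ < 1)
    (hs : Summable (qBinomialTerm α x q)) :
    (1 - x) * ∑' n, qBinomialTerm α x q n =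
      (1 - α * x) * ∑' n, qBinomialTerm α (x * q) q n := by
  have hs' : Summable (qBinomialTerm α (x * q) q) := by
    simpa using hs.qBinomialTerm_mul_pow hq 1
  have hscale : ∀ n, qBinomialTerm α (x * q) q n = qBinomialTerm α x q n * q ^ n := fun n => by
    simpa using qBinomialTerm_mul_pow α x q 1 n
  have h1 : ∑' n, (qBinomialTerm α x q n - qBinomialTerm α (x * q) q n) =
      ∑' n, x * (qBinomialTerm α x q n - α * qBinomialTerm α (x * q) q n) := by
    rw [(hs.sub hs').tsum_eq_zero_add, qBinomialTerm_zero, qBinomialTerm_zero, sub_self, zero_add]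
    refine tsum_congr fun n => ?_
    rw [hscale, hscale]
    linear_combination qBinomialTerm_succ hq α x n
  rw [hs.tsum_sub hs', tsum_mul_left, hs.tsum_sub (hs'.mul_left α), tsum_mul_left] at h1
  linear_combination h1

theorem tendsto_tsum_qBinomialTerm {q α x : ℂ} (hq : ‖q‖ < 1)
    (hs : Summable (qBinomialTerm α x q)) :
    Tendsto (fun j : ℕ => ∑' n, qBinomialTerm α (x * q ^ j) q n) atTop (𝓝 1) := by
  have hlim := tendsto_tsum_of_dominated_convergence (𝓕 := atTop)
    (f := fun (j : ℕ) n => qBinomialTerm α (x * q ^ j) q n)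
    (g := fun n => if n = 0 then (1 : ℂ) else 0) hs.norm ?_ ?_
  · simpa using hlim
  · rintro (_ | n)
    · simp [qBinomialTerm_zero]
    · have h := (tendsto_pow_atTop_nhds_zero_of_norm_lt_one
        (x := q ^ (n + 1)) (by simpa using pow_lt_one₀ (norm_nonneg q) hq n.succ_ne_zero)).const_mul
        (qBinomialTerm α x q (n + 1))
      simpa [qBinomialTerm_mul_pow, ← pow_mul, mul_comm] using h
  · refine Eventually.of_forall fun j n => ?_
    rw [qBinomialTerm_mul_pow, norm_mul]
    exact mul_le_of_le_one_right (norm_nonneg _) (norm_pow_le_one hq _)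

/-- The `q`-binomial theorem at every point of absolute convergence. The condition `‖x‖ < 1` is
not needed, so that terminating series are covered too. -/
theorem tsum_qBinomialTerm {q α x : ℂ} (hq : ‖q‖ < 1) (hs : Summable (qBinomialTerm α x q)) :
    qPochInf x q * ∑' n, qBinomialTerm α x q n = qPochInf (α * x) q := by
  have hiter : ∀ j : ℕ, qPoch x q j * ∑' n, qBinomialTerm α x q n =
      qPoch (α * x) q j * ∑' n, qBinomialTerm α (x * q ^ j) q n := by
    intro j
    induction j with
    | zero => simp [qPoch_zero]
    | succ j ih =>
      have h := one_sub_mul_tsum_qBinomialTerm hq (hs.qBinomialTerm_mul_pow hq j)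
      rw [mul_assoc x, ← pow_succ] at h
      rw [qPoch_succ, qPoch_succ]
      linear_combination (1 - x * q ^ j) * ih + qPoch (α * x) q j * h
  have h1 := (tendsto_qPoch hq x).mul_const (∑' n, qBinomialTerm α x q n)
  have h2 := (tendsto_qPoch hq (α * x)).mul (tendsto_tsum_qBinomialTerm hq hs)
  rw [mul_one] at h2
  exact tendsto_nhds_unique h1 (h2.congr fun j => (hiter j).symm)

/-! ### The difference equation for the truncated `₅φ₅` sum -/

/-- The quotient `(-abzqⁿ, -zqⁿ⁺¹; q)_∞ / (azqⁿ, bz; q)_∞`. -/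
noncomputable def shiftedProd (a b z q : ℂ) (n : ℕ) : ℂ :=
  qPochInf (-(a * b * z) * q ^ n) q * qPochInf (-(q * z) * q ^ n) q /
    (qPochInf (a * z * q ^ n) q * qPochInf (b * z) q)

/-- The part of the `n`-th term of the `₅φ₅` sum that does not depend on `z`. -/
noncomputable def fivePhiFiveCoeff (a b q : ℂ) (n : ℕ) : ℂ :=
  qPoch (-q / b) q n * qPoch (-a) q n / qPoch q q n * q ^ (n.choose 2) * (-b) ^ n

/-- The left-hand side of the theorem, with the infinite products cancelled against the terms of
the sum. Zeros of `(-abz, -qz; q)_n` do no harm here, so that `z` may be replaced by `q z`. -/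
noncomputable def remainder (a b z q : ℂ) (k : ℕ) : ℂ :=
  1 - ∑ n ∈ Finset.range k,
    fivePhiFiveCoeff a b q n * (1 - a * z * q ^ (2 * n)) * z ^ n * shiftedProd a b z q n

theorem prod_mul_fivePhiFiveTerm {q a b z : ℂ} (hq : ‖q‖ < 1) {n : ℕ}
    (haz : qPochInf (a * z) q ≠ 0) (habz : qPoch (-(a * b * z)) q n ≠ 0)
    (hqz : qPoch (-(q * z)) q n ≠ 0) :
    qPochInf (-(a * b * z)) q * qPochInf (-(q * z)) q /
        (qPochInf (a * z) q * qPochInf (b * z) q) * fivePhiFiveTerm a b z q n =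
      fivePhiFiveCoeff a b q n * (1 - a * z * q ^ (2 * n)) * z ^ n * shiftedProd a b z q n := by
  have h1 := qPoch_mul_qPochInf (a * z) q hq n
  rw [← h1] at haz
  have h2 := left_ne_zero_of_mul haz
  have h3 := right_ne_zero_of_mul haz
  have h4 := qPoch_self_ne_zero hq n
  rw [← qPoch_mul_qPochInf (-(a * b * z)) q hq n, ← qPoch_mul_qPochInf (-(q * z)) q hq n, ← h1,
    fivePhiFiveTerm, fivePhiFiveCoeff, shiftedProd, ← neg_mul b z, mul_pow]
  generalize qPoch (-(q * z)) q n = y at hqz ⊢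
  field_simp

theorem fivePhiFiveCoeff_succ {q b : ℂ} (hq : ‖q‖ < 1) (hb : b ≠ 0) (a : ℂ) (n : ℕ) :
    (1 - q ^ (n + 1)) * fivePhiFiveCoeff a b q (n + 1) =
      -((b + q ^ (n + 1)) * (1 + a * q ^ n) * q ^ n) * fivePhiFiveCoeff a b q n := by
  have h1 := qPoch_self_ne_zero hq n
  have h2 := one_sub_pow_ne_zero hq n.succ_ne_zero
  have h3 : (n + 1).choose 2 = n.choose 2 + n := by
    rw [Nat.choose_succ_succ' n 1, Nat.choose_one_right, add_comm]
  rw [fivePhiFiveCoeff, fivePhiFiveCoeff, qPoch_succ, qPoch_succ, qPoch_succ, h3,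
    ← pow_succ' q n, pow_add q (n.choose 2), pow_succ (-b)]
  field_simp
  ring

theorem one_sub_mul_shiftedProd {q a z : ℂ} (hq : ‖q‖ < 1) (haz : qPochInf (a * z) q ≠ 0)
    (b : ℂ) (n : ℕ) :
    (1 - a * z * q ^ n) * shiftedProd a b z q n =
      (1 + a * b * z * q ^ n) * (1 + z * q ^ (n + 1)) * shiftedProd a b z q (n + 1) := by
  have h := qPochInf_mul_pow_ne_zero hq haz n
  rw [qPochInf_eq_mul hq] at h
  have h1 := left_ne_zero_of_mul h
  have h2 := right_ne_zero_of_mul h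
  rw [shiftedProd, shiftedProd, qPochInf_eq_mul hq (-(a * b * z) * q ^ n),
    qPochInf_eq_mul hq (-(q * z) * q ^ n), qPochInf_eq_mul hq (a * z * q ^ n)]
  simp only [mul_assoc _ (q ^ n) q, ← pow_succ] at h2 ⊢
  field_simp
  ring

theorem shiftedProd_mul_q {q b z : ℂ} (hq : ‖q‖ < 1) (hbz : qPochInf (b * z) q ≠ 0)
    (a : ℂ) (n : ℕ) :
    shiftedProd a b (q * z) q n = (1 - b * z) * shiftedProd a b z q (n + 1) := by
  have h := hbz
  rw [qPochInf_eq_mul hq] at h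
  have h1 := left_ne_zero_of_mul h
  have e1 : -(a * b * (q * z)) * q ^ n = -(a * b * z) * q ^ (n + 1) := by ring
  have e2 : -(q * (q * z)) * q ^ n = -(q * z) * q ^ (n + 1) := by ring
  have e3 : a * (q * z) * q ^ n = a * z * q ^ (n + 1) := by ring
  have e4 : b * (q * z) = b * z * q := by ring
  rw [shiftedProd, shiftedProd, e1, e2, e3, e4, qPochInf_eq_mul hq (b * z)]
  field_simp

/-- The difference equation of the truncated sum. In the induction step every quotient of
infinite products is a multiple of `shiftedProd a b z q (k + 1)`, and what remains is an identity
of polynomials. -/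
theorem remainder_sub_remainder {q a b z : ℂ} (hq : ‖q‖ < 1) (hb : b ≠ 0)
    (haz : qPochInf (a * z) q ≠ 0) (hbz : qPochInf (b * z) q ≠ 0) (k : ℕ) :
    remainder a b z q k - remainder a b (q * z) q k =
      (1 - q ^ k) * fivePhiFiveCoeff a b q k * z ^ k * shiftedProd a b z q k := by
  induction k with
  | zero => simp [remainder]
  | succ k ih =>
    have h1 := one_sub_mul_shiftedProd hq haz b k
    have h2 := shiftedProd_mul_q hq hbz a k
    have h3 := fivePhiFiveCoeff_succ hq hb a k
    rw [h3]
    unfold remainder at ih ⊢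
    rw [Finset.sum_range_succ, Finset.sum_range_succ, h2]
    linear_combination ih + fivePhiFiveCoeff a b q k * z ^ k * (-q ^ k) * h1

theorem tendsto_remainder {q : ℂ} (hq : ‖q‖ < 1) (a b z : ℂ) {k : ℕ} (hk : 1 ≤ k) :
    Tendsto (fun j : ℕ => remainder a b (q ^ j * z) q k) atTop (𝓝 0) := by
  have hz : Tendsto (fun j : ℕ => q ^ j * z) atTop (𝓝 0) := by
    simpa using (tendsto_pow_atTop_nhds_zero_of_norm_lt_one hq).mul_const z
  have hprod : ∀ n, Tendsto (fun j : ℕ => shiftedProd a b (q ^ j * z) q n) atTop (𝓝 1) := by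
    intro n
    have h := ((tendsto_qPochInf_mul_pow hq (-(a * b * z) * q ^ n)).mul
      (tendsto_qPochInf_mul_pow hq (-(q * z) * q ^ n))).div
      ((tendsto_qPochInf_mul_pow hq (a * z * q ^ n)).mul (tendsto_qPochInf_mul_pow hq (b * z)))
      (by simp)
    rw [mul_one, div_one] at h
    refine h.congr fun j => ?_
    simp only [Pi.div_apply, shiftedProd]
    ring_nf
  have hterm : ∀ n, Tendsto (fun j : ℕ => fivePhiFiveCoeff a b q n *
      (1 - a * (q ^ j * z) * q ^ (2 * n)) * (q ^ j * z) ^ n * shiftedProd a b (q ^ j * z) q n)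
      atTop (𝓝 (fivePhiFiveCoeff a b q n * (1 - a * 0 * q ^ (2 * n)) * 0 ^ n * 1)) := fun n =>
    (((((hz.const_mul a).mul_const _).const_sub 1).const_mul _).mul (hz.pow n)).mul (hprod n)
  have hsum := (tendsto_finsetSum (Finset.range k) fun n _ => hterm n).const_sub 1
  have hval : ∑ n ∈ Finset.range k,
      fivePhiFiveCoeff a b q n * (1 - a * 0 * q ^ (2 * n)) * 0 ^ n * 1 = 1 := by
    rw [Finset.sum_eq_single_of_mem 0 (Finset.mem_range.mpr hk) fun n _ hn => by simp [hn]]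
    simp [fivePhiFiveCoeff, qPoch_zero]
  rw [hval, sub_self] at hsum
  exact hsum

/-! ### The double series -/

/-- The factor of the double series that depends on the summation indices: a product of two terms
of `q`-binomial series, divided by `1 - q^(h+l+k)`. -/
noncomputable def doubleFactor (a b z q : ℂ) (k : ℕ) (p : ℕ × ℕ) : ℂ :=
  qBinomialTerm (-b) (a * z * q ^ k) q p.1 * qBinomialTerm (-q / b * q ^ k) (b * z) q p.2 /
    (1 - q ^ (p.1 + p.2 + k))

theorem doubleTerm_eq {q : ℂ} (hq : ‖q‖ < 1) (a b z : ℂ) {k : ℕ} (hk : 1 ≤ k) (h l : ℕ) :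
    doubleTerm a b z q k h l =
      qPoch (-q / b) q k * q ^ (k.choose 2) * (b * z) ^ k / qPoch q q (k - 1) *
        doubleFactor a b z q k (h, l) := by
  obtain ⟨m, rfl⟩ := Nat.exists_eq_add_of_le' hk
  have e1 : h + l + (m + 1) - 1 = h + l + m := by omega
  have e2 : h + l + m - m = h + l := by omega
  have e3 : h + l - l = h := by omega
  have n1 := qPoch_self_ne_zero hq h
  have n2 := qPoch_self_ne_zero hq l
  have n3 := qPoch_self_ne_zero hq m
  have n4 := qPoch_self_ne_zero hq (h + l)
  have n5 := qPoch_self_ne_zero hq (h + l + m)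
  have n6 := one_sub_pow_ne_zero hq (h + l + m).succ_ne_zero
  rw [doubleTerm, doubleFactor, qBinom, qBinom, if_pos (by omega), if_pos (by omega), e1,
    Nat.add_sub_cancel, e2, e3, add_comm l, qPoch_add (-q / b), ← add_assoc (h + l) m 1,
    qPoch_succ q q (h + l + m), ← pow_succ', qBinomialTerm, qBinomialTerm, pow_add (b * z) (m + 1),
    mul_right_comm a z]
  dsimp only
  generalize -q / b = c
  field_simp

theorem neg_one_pow_mul_coeff {q : ℂ} (hq : ‖q‖ < 1) (a b z : ℂ) {k : ℕ} (hk : 1 ≤ k) :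
    (-1) ^ k * qPoch (-a) q k *
        (qPoch (-q / b) q k * q ^ (k.choose 2) * (b * z) ^ k / qPoch q q (k - 1)) =
      (1 - q ^ k) * fivePhiFiveCoeff a b q k * z ^ k := by
  obtain ⟨m, rfl⟩ := Nat.exists_eq_add_of_le' hk
  have n1 := qPoch_self_ne_zero hq m
  have n2 := one_sub_pow_ne_zero hq m.succ_ne_zero
  rw [fivePhiFiveCoeff, Nat.add_sub_cancel, qPoch_succ q q m, ← pow_succ', ← neg_one_mul b,
    mul_pow (-1) b, mul_pow b z]
  field_simp

theorem norm_one_sub_pow_le {q : ℂ} (hq : ‖q‖ < 1) (n : ℕ) : ‖1 - q ^ n‖ ≤ 2 := by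
  refine (norm_sub_le _ _).trans ?_
  rw [norm_one]
  linarith [norm_pow_le_one hq n]

theorem summable_doubleFactor {q a b z : ℂ} (hq : ‖q‖ < 1) {k : ℕ} (hk : 1 ≤ k)
    (hu : Summable (qBinomialTerm (-b) (a * z * q ^ k) q))
    (hv : Summable (qBinomialTerm (-q / b * q ^ k) (b * z) q)) :
    Summable (doubleFactor a b z q k) := by
  refine Summable.of_norm_bounded
    ((summable_mul_of_summable_norm hu.norm hv.norm).norm.mul_right (1 - ‖q‖)⁻¹) fun p => ?_
  rw [doubleFactor, norm_div, div_eq_mul_inv]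
  have h1 : 1 - ‖q‖ ≤ ‖1 - q ^ (p.1 + p.2 + k)‖ := by
    have h2 := norm_sub_norm_le 1 (q ^ (p.1 + p.2 + k))
    have h3 : ‖q‖ ^ (p.1 + p.2 + k) ≤ ‖q‖ :=
      pow_le_of_le_one (norm_nonneg q) hq.le (by omega)
    rw [norm_one, norm_pow] at h2
    linarith
  have h4 : 0 < 1 - ‖q‖ := sub_pos.mpr hq
  gcongr

/-- Absolute convergence of the double series forces that of both `q`-binomial series: multiply by
the bounded factor `1 - q^(h+l+k)` and restrict to `l = 0` or `h = 0`. -/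
theorem summable_qBinomialTerm_of_doubleFactor {q a b z : ℂ} (hq : ‖q‖ < 1) {k : ℕ} (hk : 1 ≤ k)
    (hs : Summable (doubleFactor a b z q k)) :
    Summable (qBinomialTerm (-b) (a * z * q ^ k) q) ∧
      Summable (qBinomialTerm (-q / b * q ^ k) (b * z) q) := by
  have hprod : Summable fun p : ℕ × ℕ => qBinomialTerm (-b) (a * z * q ^ k) q p.1 *
      qBinomialTerm (-q / b * q ^ k) (b * z) q p.2 := by
    refine Summable.of_norm_bounded (hs.norm.mul_right 2) fun p => ?_
    have h0 : 1 - q ^ (p.1 + p.2 + k) ≠ 0 := one_sub_pow_ne_zero hq (by omega)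
    rw [← div_mul_cancel₀ (qBinomialTerm (-b) (a * z * q ^ k) q p.1 *
      qBinomialTerm (-q / b * q ^ k) (b * z) q p.2) h0, norm_mul]
    exact mul_le_mul_of_nonneg_left (norm_one_sub_pow_le hq _) (norm_nonneg _)
  constructor
  · simpa [Function.comp_def, qBinomialTerm_zero] using
      hprod.comp_injective (Prod.mk_left_injective (0 : ℕ))
  · simpa [Function.comp_def, qBinomialTerm_zero] using
      hprod.comp_injective (Prod.mk_right_injective (0 : ℕ))

theorem shiftedProd_eq_tsum_mul_tsum {q a b z : ℂ} (hq : ‖q‖ < 1) (hb : b ≠ 0)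
    (haz : qPochInf (a * z) q ≠ 0) (hbz : qPochInf (b * z) q ≠ 0) {k : ℕ}
    (hu : Summable (qBinomialTerm (-b) (a * z * q ^ k) q))
    (hv : Summable (qBinomialTerm (-q / b * q ^ k) (b * z) q)) :
    shiftedProd a b z q k = (∑' n, qBinomialTerm (-b) (a * z * q ^ k) q n) *
      ∑' n, qBinomialTerm (-q / b * q ^ k) (b * z) q n := by
  have e1 : -(a * b * z) * q ^ k = -b * (a * z * q ^ k) := by ring
  have e2 : -(q * z) * q ^ k = -q / b * q ^ k * (b * z) := by field_simp
  have haz' := qPochInf_mul_pow_ne_zero hq haz k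
  rw [shiftedProd, e1, e2, ← tsum_qBinomialTerm hq hu, ← tsum_qBinomialTerm hq hv,
    mul_mul_mul_comm, mul_div_cancel_left₀ _ (mul_ne_zero haz' hbz)]

theorem doubleFactor_mul_pow (a b z q : ℂ) (k j : ℕ) (p : ℕ × ℕ) :
    doubleFactor a b (q ^ j * z) q k p = doubleFactor a b z q k p * q ^ (j * (p.1 + p.2)) := by
  have e1 : a * (q ^ j * z) * q ^ k = a * z * q ^ k * q ^ j := by ring
  have e2 : b * (q ^ j * z) = b * z * q ^ j := by ring
  rw [doubleFactor, doubleFactor, e1, e2, qBinomialTerm_mul_pow, qBinomialTerm_mul_pow _ (b * z),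
    mul_mul_mul_comm, ← pow_add, ← mul_add, mul_div_right_comm]

/-- The difference equation of the double series: the factor `1 / (1 - q^(h+l+k))` cancels, and a
product of two `q`-binomial series remains. -/
theorem tsum_doubleFactor_sub {q a b z : ℂ} (hq : ‖q‖ < 1) (hb : b ≠ 0)
    (haz : qPochInf (a * z) q ≠ 0) (hbz : qPochInf (b * z) q ≠ 0) {k : ℕ} (hk : 1 ≤ k)
    (hu : Summable (qBinomialTerm (-b) (a * z * q ^ k) q))
    (hv : Summable (qBinomialTerm (-q / b * q ^ k) (b * z) q)) :
    ∑' p, doubleFactor a b z q k p - q ^ k * ∑' p, doubleFactor a b (q * z) q k p =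
      shiftedProd a b z q k := by
  have hs := summable_doubleFactor hq hk hu hv
  have hscale : ∀ p, doubleFactor a b (q * z) q k p =
      doubleFactor a b z q k p * q ^ (p.1 + p.2) := fun p => by
    simpa using doubleFactor_mul_pow a b z q k 1 p
  have hs' : Summable (doubleFactor a b (q * z) q k) := by
    refine Summable.of_norm_bounded hs.norm fun p => ?_
    rw [hscale, norm_mul]
    exact mul_le_of_le_one_right (norm_nonneg _) (norm_pow_le_one hq _)
  rw [shiftedProd_eq_tsum_mul_tsum hq hb haz hbz hu hv,
    tsum_mul_tsum_of_summable_norm hu.norm hv.norm, ← tsum_mul_left,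
    ← hs.tsum_sub (hs'.mul_left _)]
  refine tsum_congr fun p => ?_
  have h0 : 1 - q ^ (p.1 + p.2 + k) ≠ 0 := one_sub_pow_ne_zero hq (by omega)
  rw [hscale, doubleFactor]
  field_simp
  ring

theorem tendsto_pow_mul_tsum_doubleFactor {q a b z : ℂ} (hq : ‖q‖ < 1) {k : ℕ} (hk : 1 ≤ k)
    (hs : Summable (doubleFactor a b z q k)) :
    Tendsto (fun j : ℕ => (q ^ j * z) ^ k * ∑' p, doubleFactor a b (q ^ j * z) q k p) atTop
      (𝓝 0) := by
  have hz : Tendsto (fun j : ℕ => (q ^ j * z) ^ k) atTop (𝓝 0) := by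
    simpa [show k ≠ 0 by omega] using
      ((tendsto_pow_atTop_nhds_zero_of_norm_lt_one hq).mul_const z).pow k
  refine hz.zero_mul_isBoundedUnder_le
    (isBoundedUnder_of ⟨∑' p, ‖doubleFactor a b z q k p‖, fun j => ?_⟩)
  refine tsum_of_norm_bounded hs.norm.hasSum fun p => ?_
  rw [doubleFactor_mul_pow, norm_mul]
  exact mul_le_of_le_one_right (norm_nonneg _) (norm_pow_le_one hq _)

theorem eq_of_tendsto_zero_of_sub_eq_sub {f g : ℕ → ℂ} (hf : Tendsto f atTop (𝓝 0))
    (hg : Tendsto g atTop (𝓝 0)) (h : ∀ n, f n - f (n + 1) = g n - g (n + 1)) : f 0 = g 0 := by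
  have hconst : ∀ n, f n - g n = f 0 - g 0 := by
    intro n
    induction n with
    | zero => rfl
    | succ n ih => linear_combination ih - h n
  have hlim := (hf.sub hg).congr hconst
  rw [sub_zero] at hlim
  exact sub_eq_zero.mp (tendsto_nhds_unique tendsto_const_nhds hlim)

/-- The convergence hypothesis is needed only if the constant factor does not vanish; if it does,
both sides are zero. -/
theorem remainder_eq_mul_tsum {q a b z : ℂ} (hq : ‖q‖ < 1) (hb : b ≠ 0)
    (haz : qPochInf (a * z) q ≠ 0) (hbz : qPochInf (b * z) q ≠ 0) {k : ℕ} (hk : 1 ≤ k)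
    (hs : fivePhiFiveCoeff a b q k * z ^ k ≠ 0 → Summable (doubleFactor a b z q k)) :
    remainder a b z q k =
      (1 - q ^ k) * fivePhiFiveCoeff a b q k * z ^ k * ∑' p, doubleFactor a b z q k p := by
  have hazj : ∀ j : ℕ, qPochInf (a * (q ^ j * z)) q ≠ 0 := fun j => by
    rw [mul_left_comm, mul_comm]
    exact qPochInf_mul_pow_ne_zero hq haz j
  have hbzj : ∀ j : ℕ, qPochInf (b * (q ^ j * z)) q ≠ 0 := fun j => by
    rw [mul_left_comm, mul_comm]
    exact qPochInf_mul_pow_ne_zero hq hbz j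
  have hshift : ∀ j : ℕ, q ^ (j + 1) * z = q * (q ^ j * z) := fun j => by ring
  have hL := tendsto_remainder hq a b z hk
  by_cases hC : fivePhiFiveCoeff a b q k * z ^ k = 0
  · have h := eq_of_tendsto_zero_of_sub_eq_sub hL (tendsto_const_nhds (x := (0 : ℂ))) fun j => by
      rw [hshift, remainder_sub_remainder hq hb (hazj j) (hbzj j), mul_pow]
      linear_combination (1 - q ^ k) * (q ^ j) ^ k * shiftedProd a b (q ^ j * z) q k * hC
    rw [pow_zero, one_mul] at h
    rw [h, mul_assoc (1 - q ^ k), hC, mul_zero, zero_mul]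
  · obtain ⟨hu, hv⟩ := summable_qBinomialTerm_of_doubleFactor hq hk (hs hC)
    have hR := (tendsto_pow_mul_tsum_doubleFactor hq hk (hs hC)).const_mul
      ((1 - q ^ k) * fivePhiFiveCoeff a b q k)
    rw [mul_zero] at hR
    have h := eq_of_tendsto_zero_of_sub_eq_sub hL hR fun j => by
      have huj : Summable (qBinomialTerm (-b) (a * (q ^ j * z) * q ^ k) q) := by
        convert hu.qBinomialTerm_mul_pow hq j using 2
        ring
      have hvj : Summable (qBinomialTerm (-q / b * q ^ k) (b * (q ^ j * z)) q) := by
        convert hv.qBinomialTerm_mul_pow hq j using 2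
        ring
      rw [hshift, remainder_sub_remainder hq hb (hazj j) (hbzj j),
        ← tsum_doubleFactor_sub hq hb (hazj j) (hbzj j) hk huj hvj]
      ring
    simpa only [pow_zero, one_mul, ← mul_assoc] using h

theorem theorem1p10 (q a b z : ℂ) (hq0 : 0 < ‖q‖) (hq1 : ‖q‖ < 1) (hb : b ≠ 0)
    (k : ℕ) (hk : 1 ≤ k)
    (haz : qPochInf (a * z) q ≠ 0) (hbz : qPochInf (b * z) q ≠ 0)
    (habz : ∀ n < k, qPoch (-(a * b * z)) q n ≠ 0)
    (hqz : ∀ n < k, qPoch (-(q * z)) q n ≠ 0) :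
    (‖a * q ^ k * z‖ < 1 → ‖b * z‖ < 1 →
      Summable (fun p : ℕ × ℕ => doubleTerm a b z q k p.1 p.2)) ∧
    (Summable (fun p : ℕ × ℕ => doubleTerm a b z q k p.1 p.2) →
      1 - qPochInf (-(a * b * z)) q * qPochInf (-(q * z)) q /
            (qPochInf (a * z) q * qPochInf (b * z) q) *
          ∑ n ∈ Finset.range k, fivePhiFiveTerm a b z q n =
        (-1) ^ k * qPoch (-a) q k *
          ∑' p : ℕ × ℕ, doubleTerm a b z q k p.1 p.2) := by
  simp only [doubleTerm_eq hq1 a b z hk, Prod.mk.eta]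
  constructor
  · intro hx hy
    rw [mul_right_comm] at hx
    exact (summable_doubleFactor hq1 hk (summable_qBinomialTerm hq1 _ hx)
      (summable_qBinomialTerm hq1 _ hy)).mul_left _
  · intro hs
    rw [tsum_mul_left, ← mul_assoc, neg_one_pow_mul_coeff hq1 a b z hk,
      ← remainder_eq_mul_tsum hq1 hb haz hbz hk ?_, remainder, Finset.mul_sum]
    · congr 1
      refine Finset.sum_congr rfl fun n hn => ?_
      rw [Finset.mem_range] at hn
      exact prod_mul_fivePhiFiveTerm hq1 haz (habz n hn) (hqz n hn)
    · intro hC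
      refine (summable_mul_left_iff fun h0 => hC ?_).mp hs
      have h := neg_one_pow_mul_coeff hq1 a b z hk
      rw [h0, mul_zero, mul_assoc] at h
      exact (mul_eq_zero.mp h.symm).resolve_left (one_sub_pow_ne_zero hq1 (by omega))
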